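/- Let $f$ be a function analytic on the unit disc $\{z\in\mathbb C: |z|<1\}$, with Taylor expansion $f(z)=\sum_{k\ge 0}a_kz^k$ at $0$. Assume that $f$ is transcendental, that is, for every non-zero polynomial $P\in\mathbb C[X,Y]$ the function $P(z,f(z))$ does not vanish identically on the unit disc. Assume that all $a_k$ are rational, and write $a_k=m_k/p_k$ in lowest terms with $p_k>0$. For $d\ge 1$ let $\nu_d$ be the $d$-th transcendence index of $f$: the maximum, over all non-zero $P\in\mathbb C[X,Y]$ of total degree at most $d$, of the multiplicity at $0$ of $z\mapsto P(z,f(z))$. For $l\ge 1$ let $h_l=\max\{p_k: 1\le k\le l\}$. Suppose that there are real polynomials $R$ and $S$ such that $$\nu_d\le R(d)\quad\text{and}\quad h_l\le e^{S(l)}\qquad\text{for all integers } d,l\ge 1 .$$ For $d\ge 1$ let $\mathcal Z_d(f)$ be the maximal number of zeros, counted with multiplicity, in the closed disc $D_{1/4}=\{z\in\mathbb C:|z|\le \tfrac14\}$ of the functions $\sum_{0\le i,j\le d}\lambda_{j,i}\,z^i f(z)^j$, where the coefficients $\lambda_{j,i}\in\mathbb C$ are not all zero. Then there is a real polynomial $T$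 such that $\mathcal Z_d(f)\le T(d)$ for all integers $d\ge 1$. -/

import Mathlib

open scoped ENNReal

/-- The function `z ↦ P(z, f(z))`. -/
noncomputable def alongGraph (f : ℂ → ℂ) (P : MvPolynomial (Fin 2) ℂ) : ℂ → ℂ :=
  fun z => MvPolynomial.eval ![z, f z] P

/-- `f` is transcendental on the open unit disc: no non-zero polynomial in two variables vanishes
identically on its graph. -/
def IsTranscendentalOnDisc (f : ℂ → ℂ) : Prop :=
  ∀ P : MvPolynomial (Fin 2) ℂ, P ≠ 0 →
    ∃ z ∈ Metric.ball (0 : ℂ) 1, alongGraph f P z ≠ 0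

/-- The `d`-th transcendence index `ν_d(f)`: the largest multiplicity at `0` of `P(z, f(z))` among
the non-zero polynomials `P` of total degree at most `d`. It is `⊤` if there is no largest
multiplicity, or if some such `P(z, f(z))` vanishes identically near `0`. -/
noncomputable def transcendenceIndex (f : ℂ → ℂ) (d : ℕ) : ℕ∞ :=
  ⨆ P : MvPolynomial (Fin 2) ℂ,
    ⨆ (_ : P ∈ MvPolynomial.restrictTotalDegree (Fin 2) ℂ d ∧ P ≠ 0),
      analyticOrderAt (alongGraph f P) 0

/-- The number of zeros of `g` in `D`, counted with multiplicity, as an extended natural number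
(the supremum of the partial counts over finite subsets of `D`). -/
noncomputable def zeroCount (g : ℂ → ℂ) (D : Set ℂ) : ℕ∞ :=
  ⨆ s : Finset ℂ, ⨆ (_ : (s : Set ℂ) ⊆ D), ∑ z ∈ s, analyticOrderAt g z

/-- The number `𝒵_d(f)` on `D`: the largest number of zeros in `D`, counted with multiplicity,
of a function `∑_{0 ≤ i, j ≤ d} λ_{j,i} z^i f(z)^j` whose coefficients are not all zero. -/
noncomputable def bezoutNumber (f : ℂ → ℂ) (D : Set ℂ) (d : ℕ) : ℕ∞ :=
  ⨆ P : MvPolynomial (Fin 2) ℂ,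
    ⨆ (_ : P ∈ MvPolynomial.restrictDegree (Fin 2) ℂ d ∧ P ≠ 0),
      zeroCount (alongGraph f P) D

/-- `h_l`, the largest denominator (in lowest terms) of `a_1, …, a_l`. -/
def maxDenominator (a : ℕ → ℚ) (l : ℕ) : ℕ :=
  (Finset.Icc 1 l).sup fun k => (a k).den

/-! ### Functions with many zeros are small -/

/-! Write `g = ∑ v_{ij} z^i f^j` with `L = max |v_{ij}| > 0`, and suppose that `g` has `K` zeros in
the disc of radius `1/4`. By a Schwarz-type estimate `|g|` is at most a constant times `L (4/5)^K`
there, so by Cauchy all Taylor coefficients of `g` at `0` are small. Conversely, they cannot all be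
small. Let `N ≥ ν_{2d}`. The Taylor coefficients of the `z^i f^j` up to order `N`, multiplied by a
common denominator, form an integer matrix, whose kernel is trivial because no non-zero `g` vanishes
to order above `N`. Its Gram determinant is a non-zero integer, hence at least `1` in modulus, and
Cramer's rule bounds `L` by an explicit factor times the largest coefficient of `g` up to order `N`
(`Matrix.norm_apply_le_of_int_of_injective`). Cancelling `L` leaves `(5/4)^K ≤ C`
(`pow_le_of_le_sum_analyticOrderAt_alongGraph`). The growth hypotheses make `log C` polynomial in
`d`. -/

/-- Divide out one zero `w` at a time: `|z - w| ≥ 7/8 - 1/4 = 5/8` on the outer circle and `|z - w|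
≤ 1/2` on the small disc, so each zero gains `(1/2)(8/5) = 4/5`. The maximum principle is the base
case. -/
theorem norm_le_of_le_sum_analyticOrderAt (s : Finset ℂ)
    (hs : (s : Set ℂ) ⊆ Metric.closedBall 0 (1 / 4)) (K : ℕ) :
    ∀ (g : ℂ → ℂ) (M : ℝ), DifferentiableOn ℂ g (Metric.ball 0 1) →
      (∀ z ∈ Metric.sphere (0 : ℂ) (7 / 8), ‖g z‖ ≤ M) →
      (K : ℕ∞) ≤ ∑ w ∈ s, analyticOrderAt g w →
      ∀ z ∈ Metric.closedBall (0 : ℂ) (1 / 4), ‖g z‖ ≤ M * (4 / 5) ^ K := by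
  induction K with
  | zero =>
    intro g M hg hM _ z hz
    have hcl : closure (Metric.ball (0 : ℂ) (7 / 8)) = Metric.closedBall 0 (7 / 8) :=
      closure_ball _ (by norm_num)
    have hd : DiffContOnCl ℂ g (Metric.ball 0 (7 / 8)) := by
      apply DifferentiableOn.diffContOnCl
      rw [hcl]
      exact hg.mono (Metric.closedBall_subset_ball (by norm_num))
    rw [pow_zero, mul_one]
    refine Complex.norm_le_of_forall_mem_frontier_norm_le Metric.isBounded_ball hd ?_ ?_
    · rwa [frontier_ball _ (by norm_num)]
    · rw [hcl]
      exact Metric.closedBall_subset_closedBall (by norm_num) hz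
  | succ K ih =>
    intro g M hg hM hK z hz
    obtain ⟨w, hw, hw0⟩ : ∃ w ∈ s, analyticOrderAt g w ≠ 0 := by
      by_contra! h
      rw [Finset.sum_eq_zero h] at hK
      simp at hK
    have hw4 : ‖w‖ ≤ 1 / 4 := by simpa using hs hw
    have hwb : w ∈ Metric.ball (0 : ℂ) 1 := by
      rw [mem_ball_zero_iff]; linarith
    have hnhds : ∀ u ∈ s, Metric.ball (0 : ℂ) 1 ∈ nhds u := fun u hu =>
      Metric.isOpen_ball.mem_nhds (Metric.closedBall_subset_ball (by norm_num) (hs hu))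
    have hgw : g w = 0 :=
      (AnalyticAt.analyticOrderAt_ne_zero (hg.analyticAt (hnhds w hw))).1 hw0
    have hg1 : DifferentiableOn ℂ (dslope g w) (Metric.ball 0 1) :=
      (Complex.differentiableOn_dslope (hnhds w hw)).2 hg
    have hmul : ∀ u, g u = (u - w) * dslope g w u := fun u => by
      have := sub_smul_dslope g w u
      rw [hgw, sub_zero, smul_eq_mul] at this
      exact this.symm
    have hord : ∀ u ∈ s, analyticOrderAt g u =
        (if u = w then 1 else 0) + analyticOrderAt (dslope g w) u := by
      intro u hu
      have hfun : g = (fun u => u - w) * dslope g w := funext hmul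
      have hsub : AnalyticAt ℂ (fun u : ℂ => u - w) u := by fun_prop
      conv_lhs => rw [hfun]
      rw [analyticOrderAt_mul hsub (hg1.analyticAt (hnhds u hu))]
      congr 1
      split_ifs with h
      · subst h
        exact analyticOrderAt_id_sub_const_self
      · exact hsub.analyticOrderAt_eq_zero.2 (sub_ne_zero.2 h)
    have hsum : ∑ u ∈ s, analyticOrderAt g u =
        ∑ u ∈ s, analyticOrderAt (dslope g w) u + 1 := by
      rw [Finset.sum_congr rfl hord, Finset.sum_add_distrib, Finset.sum_ite_eq' s w, if_pos hw,
        add_comm]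
    have hK1 : (K : ℕ∞) ≤ ∑ u ∈ s, analyticOrderAt (dslope g w) u := by
      rw [hsum, Nat.cast_add, Nat.cast_one] at hK
      exact (ENat.add_le_add_iff_right ENat.one_ne_top).1 hK
    have hM1 : ∀ u ∈ Metric.sphere (0 : ℂ) (7 / 8), ‖dslope g w u‖ ≤ M * (8 / 5) := by
      intro u hu
      have h1 := hM u hu
      rw [hmul u, norm_mul] at h1
      have h2 : (5 / 8 : ℝ) ≤ ‖u - w‖ := by
        have := norm_sub_norm_le u w
        rw [mem_sphere_zero_iff_norm] at hu
        linarith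
      nlinarith [norm_nonneg (dslope g w u)]
    have h3 := ih (dslope g w) _ hg1 hM1 hK1 z hz
    have h4 : ‖z - w‖ ≤ 1 / 2 := by
      have := norm_sub_le z w
      rw [mem_closedBall_zero_iff] at hz
      linarith
    rw [hmul z, norm_mul]
    calc ‖z - w‖ * ‖dslope g w z‖ ≤ 1 / 2 * (M * (8 / 5) * (4 / 5) ^ K) := by gcongr
      _ = M * (4 / 5) ^ (K + 1) := by ring

/-! ### Integer matrices with trivial kernel -/

namespace Matrix

variable {ι κ : Type*} [Fintype ι] [Fintype κ] [DecidableEq ι]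

theorem norm_adjugate_apply_le (G : Matrix ι ι ℂ) {x : ℝ} (hx : 1 ≤ x) (hG : ∀ i j, ‖G i j‖ ≤ x)
    (i j : ι) : ‖G.adjugate i j‖ ≤ (Fintype.card ι).factorial * x ^ Fintype.card ι := by
  rw [adjugate_apply]
  have := det_le (A := G.updateRow j (Pi.single i 1)) (abv := IsAbsoluteValue.toAbsoluteValue
    (norm : ℂ → ℝ)) (x := x) ?_
  · simpa using this
  · intro k l
    change ‖G.updateRow j (Pi.single i 1) k l‖ ≤ x
    rw [updateRow_apply]
    split_ifs
    · rw [Pi.single_apply]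
      split_ifs
      · simpa using hx
      · simpa using zero_le_one.trans hx
    · exact hG k l

/-- `B` need not be square, so Cramer's rule is applied to the Gram matrix `G = Aᴴ A`. It has the
same kernel as `A`, and its determinant is a non-zero integer, so dividing by it costs nothing. -/
theorem norm_apply_le_of_int_of_injective (B : Matrix κ ι ℤ) {b : ℝ} (hb : ∀ k i, |(B k i : ℝ)| ≤ b)
    (hb1 : 1 ≤ Fintype.card κ * b ^ 2)
    (hB : ∀ v : ι → ℂ, B.map (Int.cast : ℤ → ℂ) *ᵥ v = 0 → v = 0) (v : ι → ℂ) {y : ℝ}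
    (hb0 : 0 ≤ b)
    (hy : ∀ k, ‖(B.map (Int.cast : ℤ → ℂ) *ᵥ v) k‖ ≤ y) (i : ι) :
    ‖v i‖ ≤ Fintype.card ι * ((Fintype.card ι).factorial *
      (Fintype.card κ * b ^ 2) ^ Fintype.card ι * (Fintype.card κ * (b * y))) := by
  set A : Matrix κ ι ℂ := B.map (Int.cast : ℤ → ℂ) with hA
  have hAn : ∀ k i, ‖A k i‖ ≤ b := fun k i => by simpa [hA] using hb k i
  have hAH : Aᴴ = Bᵀ.map (Int.cast : ℤ → ℂ) := by
    ext p q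
    simp [hA]
  set G : Matrix ι ι ℂ := Aᴴ * A with hG
  have hGint : G = (Bᵀ * B).map (Int.cast : ℤ → ℂ) := by
    rw [hG, hAH, hA]
    exact (Matrix.map_mul (f := Int.castRingHom ℂ)).symm
  have hdet : G.det = ((Bᵀ * B).det : ℂ) := by
    rw [hGint]
    exact ((Int.castRingHom ℂ).map_det (Bᵀ * B)).symm
  have hdet0 : G.det ≠ 0 := by
    intro h0
    obtain ⟨u, hu, hu0⟩ := exists_mulVec_eq_zero_iff.2 h0
    exact hu (hB u ((open scoped ComplexOrder in
      conjTranspose_mul_self_mulVec_eq_zero A u).1 hu0))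
  have hdet1 : 1 ≤ ‖G.det‖ := by
    rw [hdet] at hdet0 ⊢
    rw [Complex.norm_intCast]
    exact_mod_cast Int.one_le_abs (by exact_mod_cast hdet0)
  have hGn : ∀ i j, ‖G i j‖ ≤ Fintype.card κ * b ^ 2 := by
    intro p q
    rw [hG, mul_apply]
    refine (norm_sum_le _ _).trans ?_
    rw [← nsmul_eq_mul, Fintype.card, ← Finset.sum_const]
    refine Finset.sum_le_sum fun k _ => ?_
    rw [norm_mul, conjTranspose_apply, norm_star, sq]
    exact mul_le_mul (hAn k p) (hAn k q) (norm_nonneg _) hb0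
  have hw : ∀ j, ‖(Aᴴ *ᵥ (A *ᵥ v)) j‖ ≤ Fintype.card κ * (b * y) := by
    intro j
    refine (norm_sum_le _ _).trans ?_
    rw [← nsmul_eq_mul, Fintype.card, ← Finset.sum_const]
    refine Finset.sum_le_sum fun k _ => ?_
    rw [norm_mul]
    change ‖Aᴴ j k‖ * ‖(A *ᵥ v) k‖ ≤ b * y
    rw [conjTranspose_apply, norm_star]
    exact mul_le_mul (hAn k j) (hy k) (norm_nonneg _) hb0
  have hcramer : G.adjugate *ᵥ (Aᴴ *ᵥ (A *ᵥ v)) = G.det • v := by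
    rw [mulVec_mulVec (M := Aᴴ), mulVec_mulVec, ← hG, adjugate_mul, smul_mulVec, one_mulVec]
  have hi := congrFun hcramer i
  calc ‖v i‖ ≤ ‖G.det‖ * ‖v i‖ := le_mul_of_one_le_left (norm_nonneg _) hdet1
    _ = ‖(G.adjugate *ᵥ (Aᴴ *ᵥ (A *ᵥ v))) i‖ := by
      rw [hi, Pi.smul_apply, smul_eq_mul, norm_mul]
    _ ≤ _ := by
      refine (norm_sum_le _ _).trans ?_
      rw [← nsmul_eq_mul (Fintype.card ι), Fintype.card, ← Finset.sum_const]
      refine Finset.sum_le_sum fun j _ => ?_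
      rw [norm_mul]
      exact mul_le_mul (norm_adjugate_apply_le G hb1 hGn i j) (hw j) (norm_nonneg _) (by positivity)

end Matrix

/-! ### Taylor coefficients -/

/-- The `k`-th Taylor coefficient of `g` at `0`. -/
noncomputable def taylorCoeff (g : ℂ → ℂ) (k : ℕ) : ℂ :=
  iteratedDeriv k g 0 / (k.factorial : ℂ)

theorem taylorCoeff_mul {g h : ℂ → ℂ} (hg : AnalyticAt ℂ g 0) (hh : AnalyticAt ℂ h 0) (k : ℕ) :
    taylorCoeff (fun z => g z * h z) k =
      ∑ i ∈ Finset.range (k + 1), taylorCoeff g i * taylorCoeff h (k - i) := by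
  unfold taylorCoeff
  rw [iteratedDeriv_fun_mul hg.contDiffAt hh.contDiffAt, Finset.sum_div]
  refine Finset.sum_congr rfl fun i hi => ?_
  have hik : i ≤ k := Nat.lt_succ_iff.1 (Finset.mem_range.1 hi)
  rw [← Nat.choose_mul_factorial_mul_factorial hik]
  have h1 : (k.choose i : ℂ) ≠ 0 := by exact_mod_cast (Nat.choose_pos hik).ne'
  have h2 : (i.factorial : ℂ) ≠ 0 := by exact_mod_cast i.factorial_ne_zero
  have h3 : ((k - i).factorial : ℂ) ≠ 0 := by exact_mod_cast (k - i).factorial_ne_zero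
  push_cast
  field_simp

theorem taylorCoeff_sum_const_mul {ι : Type*} (s : Finset ι) (c : ι → ℂ) (φ : ι → ℂ → ℂ)
    (hφ : ∀ i ∈ s, AnalyticAt ℂ (φ i) 0) (k : ℕ) :
    taylorCoeff (fun z => ∑ i ∈ s, c i * φ i z) k = ∑ i ∈ s, c i * taylorCoeff (φ i) k := by
  unfold taylorCoeff
  have hc : ∀ i ∈ s, ContDiffAt ℂ k (fun z => c i * φ i z) 0 := fun i hi =>
    (analyticAt_const.fun_mul (hφ i hi)).contDiffAt
  rw [iteratedDeriv_fun_sum hc, Finset.sum_div]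
  refine Finset.sum_congr rfl fun i hi => ?_
  rw [iteratedDeriv_const_mul_field, mul_div_assoc]

theorem norm_taylorCoeff_le {g : ℂ → ℂ} {r M : ℝ} (hr : 0 < r) (hr1 : r < 1)
    (hg : DifferentiableOn ℂ g (Metric.ball 0 1))
    (hM : ∀ z ∈ Metric.sphere (0 : ℂ) r, ‖g z‖ ≤ M) (k : ℕ) : ‖taylorCoeff g k‖ ≤ M / r ^ k := by
  have hd : DiffContOnCl ℂ g (Metric.ball 0 r) := by
    apply DifferentiableOn.diffContOnCl
    rw [closure_ball _ hr.ne']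
    exact hg.mono (Metric.closedBall_subset_ball hr1)
  have h := Complex.norm_iteratedDeriv_le_of_forall_mem_sphere_norm_le k hr hd hM
  have hk : (0 : ℝ) < k.factorial := by exact_mod_cast k.factorial_pos
  rw [taylorCoeff, norm_div, Complex.norm_natCast, div_le_iff₀ hk]
  exact h.trans_eq (by ring)

theorem le_analyticOrderAt_of_taylorCoeff_eq_zero {g : ℂ → ℂ} (hg : AnalyticAt ℂ g 0) {N : ℕ}
    (h : ∀ k ≤ N, taylorCoeff g k = 0) : ((N + 1 : ℕ) : ℕ∞) ≤ analyticOrderAt g 0 := by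
  rw [natCast_le_analyticOrderAt_iff_iteratedDeriv_eq_zero hg]
  intro i hi
  have := h i (Nat.lt_succ_iff.1 hi)
  rw [taylorCoeff, div_eq_zero_iff] at this
  exact this.resolve_right (by exact_mod_cast i.factorial_ne_zero)

theorem taylorCoeff_const (c : ℂ) (k : ℕ) :
    taylorCoeff (fun _ => c) k = if k = 0 then c else 0 := by
  rw [taylorCoeff, iteratedDeriv_const]
  split_ifs with h
  · simp [h]
  · simp

theorem taylorCoeff_id (k : ℕ) : taylorCoeff (fun z => z) k = if k = 1 then 1 else 0 := by
  rcases k with _ | _ | k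
  · simp [taylorCoeff]
  · simp [taylorCoeff, iteratedDeriv_one]
  · have : deriv (fun z : ℂ => z) = fun _ => 1 := by funext z; simp
    simp [taylorCoeff, iteratedDeriv_succ', this, iteratedDeriv_const]

/-- All Taylor coefficients of `g` at `0` up to order `N` lie in `q⁻¹ℤ`. -/
def HasDenominator (N : ℕ) (q : ℤ) (g : ℂ → ℂ) : Prop :=
  ∀ k ≤ N, ∃ m : ℤ, (q : ℂ) * taylorCoeff g k = m

namespace HasDenominator

variable {N : ℕ} {p q : ℤ} {g h : ℂ → ℂ}

theorem mul (hg : AnalyticAt ℂ g 0) (hh : AnalyticAt ℂ h 0) (hp : HasDenominator N p g)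
    (hq : HasDenominator N q h) : HasDenominator N (p * q) (fun z => g z * h z) := by
  intro k hk
  have h1 : ∀ i, i ≤ k → ∃ m : ℤ, (p : ℂ) * taylorCoeff g i = m := fun i hi => hp i (hi.trans hk)
  have h2 : ∀ i, ∃ m : ℤ, (q : ℂ) * taylorCoeff h (k - i) = m := fun i =>
    hq _ ((Nat.sub_le _ _).trans hk)
  choose! m hm using h1
  choose n hn using h2
  refine ⟨∑ i ∈ Finset.range (k + 1), m i * n i, ?_⟩
  rw [taylorCoeff_mul hg hh, Finset.mul_sum]
  push_cast
  refine Finset.sum_congr rfl fun i hi => ?_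
  rw [← hm i (Nat.lt_succ_iff.1 (Finset.mem_range.1 hi)), ← hn i]
  ring

theorem one : HasDenominator N 1 (fun _ => 1) := by
  intro k _
  refine ⟨if k = 0 then 1 else 0, ?_⟩
  rw [taylorCoeff_const]
  split_ifs <;> simp

theorem id : HasDenominator N 1 (fun z => z) := by
  intro k _
  refine ⟨if k = 1 then 1 else 0, ?_⟩
  rw [taylorCoeff_id]
  split_ifs <;> simp

theorem pow (hg : AnalyticAt ℂ g 0) (hq : HasDenominator N q g) (j : ℕ) :
    HasDenominator N (q ^ j) (fun z => g z ^ j) := by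
  induction j with
  | zero => simpa using one
  | succ j ih => simpa only [pow_succ] using ih.mul (hg.fun_pow j) hg hq

theorem of_dvd (hp : HasDenominator N p g) (hpq : p ∣ q) : HasDenominator N q g := by
  obtain ⟨c, rfl⟩ := hpq
  intro k hk
  obtain ⟨m, hm⟩ := hp k hk
  refine ⟨c * m, ?_⟩
  push_cast
  rw [← hm]
  ring

end HasDenominator

theorem hasDenominator_prod_den {f : ℂ → ℂ} {a : ℕ → ℚ} (ha : ∀ k, taylorCoeff f k = (a k : ℂ))
    (N : ℕ) : HasDenominator N (∏ k ∈ Finset.range (N + 1), ((a k).den : ℤ)) f := by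
  intro k hk
  obtain ⟨c, hc⟩ := Finset.dvd_prod_of_mem (fun k => ((a k).den : ℤ))
    (Finset.mem_range.2 (Nat.lt_succ_iff.2 hk))
  refine ⟨c * (a k).num, ?_⟩
  rw [hc, ha]
  have h : ((a k).den : ℂ) * (a k : ℂ) = ((a k).num : ℂ) := by
    exact_mod_cast congrArg (Rat.cast : ℚ → ℂ) (Rat.den_mul_eq_num (a k))
  push_cast
  rw [← h]
  ring

/-- `h_N` ignores `a_0`, whose denominator is therefore split off. The plain product is a wasteful
common denominator, but its logarithm stays polynomial in `N`. -/
theorem prod_den_le (a : ℕ → ℚ) (N : ℕ) :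
    ∏ k ∈ Finset.range (N + 1), (a k).den ≤ (a 0).den * maxDenominator a N ^ N := by
  rw [Finset.prod_range_succ', mul_comm]
  refine Nat.mul_le_mul_left _ ?_
  calc ∏ k ∈ Finset.range N, (a (k + 1)).den ≤ ∏ _k ∈ Finset.range N, maxDenominator a N := by
        refine Finset.prod_le_prod' fun k hk => ?_
        refine Finset.le_sup (f := fun k => (a k).den) (Finset.mem_Icc.2 ⟨by omega, ?_⟩)
        have := Finset.mem_range.1 hk
        omega
    _ = _ := by simp

/-! ### Polynomials with bounded partial degrees -/

/-- The exponent of the monomial `X ^ i * Y ^ j`. -/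
noncomputable def boxExponent {d : ℕ} (p : Fin (d + 1) × Fin (d + 1)) : Fin 2 →₀ ℕ :=
  Finsupp.single 0 (p.1 : ℕ) + Finsupp.single 1 (p.2 : ℕ)

/-- The polynomial `∑_{0 ≤ i, j ≤ d} v (i, j) X ^ i Y ^ j`. -/
noncomputable def boxPolynomial {d : ℕ} (v : Fin (d + 1) × Fin (d + 1) → ℂ) :
    MvPolynomial (Fin 2) ℂ :=
  ∑ p, MvPolynomial.monomial (boxExponent p) (v p)

/-- The function `z ↦ z ^ i * f z ^ j`. -/
def graphMonomial (f : ℂ → ℂ) {d : ℕ} (p : Fin (d + 1) × Fin (d + 1)) : ℂ → ℂ :=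
  fun z => z ^ (p.1 : ℕ) * f z ^ (p.2 : ℕ)

theorem boxExponent_injective {d : ℕ} : Function.Injective (boxExponent (d := d)) := by
  intro p q h
  have h0 := DFunLike.congr_fun h 0
  have h1 := DFunLike.congr_fun h 1
  simp only [boxExponent, Finsupp.add_apply] at h0 h1
  refine Prod.ext (Fin.ext ?_) (Fin.ext ?_)
  · simpa using h0
  · simpa using h1

theorem coeff_boxPolynomial {d : ℕ} (v : Fin (d + 1) × Fin (d + 1) → ℂ)
    (p : Fin (d + 1) × Fin (d + 1)) :
    MvPolynomial.coeff (boxExponent p) (boxPolynomial v) = v p := by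
  simp [boxPolynomial, MvPolynomial.coeff_sum, MvPolynomial.coeff_monomial,
    boxExponent_injective.eq_iff]

/-- This is why the index `ν_{2d}`, not `ν_d`, enters the bound. -/
theorem boxPolynomial_mem_restrictTotalDegree {d : ℕ} (v : Fin (d + 1) × Fin (d + 1) → ℂ) :
    boxPolynomial v ∈ MvPolynomial.restrictTotalDegree (Fin 2) ℂ (2 * d) := by
  refine Submodule.sum_mem _ fun p _ => ?_
  rw [MvPolynomial.mem_restrictTotalDegree]
  refine (MvPolynomial.totalDegree_monomial_le _ _).trans ?_
  have h1 := p.1.is_lt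
  have h2 := p.2.is_lt
  have h : (boxExponent p).sum (fun _ e => e) = p.1 + p.2 := by
    rw [Finsupp.sum_fintype _ _ (fun _ => rfl), Fin.sum_univ_two]
    simp [boxExponent]
  change (boxExponent p).sum (fun _ e => e) ≤ _
  rw [h]
  omega

theorem exists_eq_boxPolynomial {d : ℕ} {P : MvPolynomial (Fin 2) ℂ}
    (hP : P ∈ MvPolynomial.restrictDegree (Fin 2) ℂ d) :
    ∃ v : Fin (d + 1) × Fin (d + 1) → ℂ, P = boxPolynomial v := by
  refine ⟨fun p => MvPolynomial.coeff (boxExponent p) P, ?_⟩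
  rw [MvPolynomial.mem_restrictDegree] at hP
  have hrange : ∀ m ∈ P.support, ∃ p : Fin (d + 1) × Fin (d + 1), boxExponent p = m := by
    intro m hm
    refine ⟨(⟨m 0, Nat.lt_succ_iff.2 (hP m hm 0)⟩, ⟨m 1, Nat.lt_succ_iff.2 (hP m hm 1)⟩), ?_⟩
    ext i
    fin_cases i <;> simp [boxExponent]
  ext m
  by_cases hm : ∃ p : Fin (d + 1) × Fin (d + 1), boxExponent p = m
  · obtain ⟨p, rfl⟩ := hm
    rw [coeff_boxPolynomial]
  · have h0 : MvPolynomial.coeff m P = 0 := by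
      by_contra h
      exact hm (hrange m (MvPolynomial.mem_support_iff.2 h))
    rw [h0, boxPolynomial, MvPolynomial.coeff_sum, Finset.sum_eq_zero]
    intro p _
    rw [MvPolynomial.coeff_monomial, if_neg fun h => hm ⟨p, h⟩]

theorem alongGraph_boxPolynomial (f : ℂ → ℂ) {d : ℕ} (v : Fin (d + 1) × Fin (d + 1) → ℂ) :
    alongGraph f (boxPolynomial v) = fun z => ∑ p, v p * graphMonomial f p z := by
  funext z
  rw [alongGraph, boxPolynomial, map_sum]
  refine Finset.sum_congr rfl fun p _ => ?_
  rw [MvPolynomial.eval_monomial, Finsupp.prod_fintype _ _ (fun _ => pow_zero _),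
    Fin.prod_univ_two]
  simp [boxExponent, graphMonomial]

section graphMonomial

variable {f : ℂ → ℂ} {d : ℕ} (p : Fin (d + 1) × Fin (d + 1))

theorem differentiableOn_graphMonomial (hf : DifferentiableOn ℂ f (Metric.ball 0 1)) :
    DifferentiableOn ℂ (graphMonomial f p) (Metric.ball 0 1) :=
  (differentiableOn_id.fun_pow _).fun_mul (hf.fun_pow _)

theorem norm_graphMonomial_le {M : ℝ} (hM : 1 ≤ M) {z : ℂ} (hz : ‖z‖ ≤ 1) (hfz : ‖f z‖ ≤ M) :
    ‖graphMonomial f p z‖ ≤ M ^ d := by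
  rw [graphMonomial, norm_mul, norm_pow, norm_pow]
  calc ‖z‖ ^ (p.1 : ℕ) * ‖f z‖ ^ (p.2 : ℕ) ≤ 1 * M ^ (p.2 : ℕ) := by
        gcongr
        exact pow_le_one₀ (norm_nonneg _) hz
    _ ≤ M ^ d := by
        rw [one_mul]
        exact pow_le_pow_right₀ hM (Nat.lt_succ_iff.1 p.2.is_lt)

theorem hasDenominator_graphMonomial (hf : AnalyticAt ℂ f 0) {N : ℕ} {q : ℤ}
    (hq : HasDenominator N q f) : HasDenominator N (q ^ d) (graphMonomial f p) := by
  refine ((HasDenominator.id.pow analyticAt_id p.1).mul (analyticAt_id.fun_pow _) (hf.fun_pow _)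
    (hq.pow hf p.2)).of_dvd ?_
  rw [one_pow, one_mul]
  exact pow_dvd_pow _ (Nat.lt_succ_iff.1 p.2.is_lt)

end graphMonomial

/-! ### Bounds for the number of zeros -/

theorem eq_zero_of_taylorCoeff_eq_zero {f : ℂ → ℂ} (hf : AnalyticAt ℂ f 0) {N d : ℕ}
    (hν : transcendenceIndex f (2 * d) ≤ N) (v : Fin (d + 1) × Fin (d + 1) → ℂ)
    (h : ∀ k ≤ N, taylorCoeff (alongGraph f (boxPolynomial v)) k = 0) : v = 0 := by
  by_contra hv
  have hP : boxPolynomial v ≠ 0 := by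
    intro h0
    apply hv
    funext p
    rw [← coeff_boxPolynomial v p, h0, MvPolynomial.coeff_zero, Pi.zero_apply]
  have hle : analyticOrderAt (alongGraph f (boxPolynomial v)) 0 ≤ N :=
    (le_iSup₂_of_le (f := fun (P : MvPolynomial (Fin 2) ℂ)
      (_ : P ∈ MvPolynomial.restrictTotalDegree (Fin 2) ℂ (2 * d) ∧ P ≠ 0) =>
        analyticOrderAt (alongGraph f P) 0) (boxPolynomial v)
      ⟨boxPolynomial_mem_restrictTotalDegree v, hP⟩ le_rfl).trans hν
  have han : AnalyticAt ℂ (alongGraph f (boxPolynomial v)) 0 := by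
    rw [alongGraph_boxPolynomial]
    exact Finset.analyticAt_fun_sum _ fun p _ => analyticAt_const.mul
      ((analyticAt_id.fun_pow _).mul (hf.fun_pow _))
  have := (le_analyticOrderAt_of_taylorCoeff_eq_zero han h).trans hle
  have h2 : N + 1 ≤ N := by exact_mod_cast this
  omega

theorem pow_le_of_le_sum_analyticOrderAt_alongGraph {f : ℂ → ℂ}
    (hf : DifferentiableOn ℂ f (Metric.ball 0 1)) {M : ℝ} (hM1 : 1 ≤ M)
    (hM : ∀ z ∈ Metric.closedBall (0 : ℂ) (7 / 8), ‖f z‖ ≤ M) {N q d : ℕ} (hq1 : 1 ≤ q)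
    (hq : HasDenominator N q f) (hν : transcendenceIndex f (2 * d) ≤ N)
    {P : MvPolynomial (Fin 2) ℂ} (hP : P ∈ MvPolynomial.restrictDegree (Fin 2) ℂ d) (hP0 : P ≠ 0)
    {s : Finset ℂ} (hs : (s : Set ℂ) ⊆ Metric.closedBall 0 (1 / 4)) {K : ℕ}
    (hK : (K : ℕ∞) ≤ ∑ w ∈ s, analyticOrderAt (alongGraph f P) w)
    {n : ℕ} (hn : n = (d + 1) * (d + 1)) {b : ℝ} (hb : b = (q : ℝ) ^ d * (M ^ d * 2 ^ N)) :
    (5 / 4 : ℝ) ^ K ≤ n * (n.factorial * ((N + 1) * b ^ 2) ^ n *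
      ((N + 1) * (b * ((q : ℝ) ^ d * (n * M ^ d * 4 ^ N))))) := by
  obtain ⟨v, rfl⟩ := exists_eq_boxPolynomial hP
  have hf0 : AnalyticAt ℂ f 0 := hf.analyticAt (Metric.ball_mem_nhds _ one_pos)
  have hcard : Fintype.card (Fin (d + 1) × Fin (d + 1)) = n := by simp [hn]
  have hq1' : (1 : ℝ) ≤ q := by exact_mod_cast hq1
  have hb1 : 1 ≤ b := by
    rw [hb]
    exact one_le_mul_of_one_le_of_one_le (one_le_pow₀ hq1')
      (one_le_mul_of_one_le_of_one_le (one_le_pow₀ hM1) (one_le_pow₀ one_le_two))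
  -- The largest coefficient `L` bounds `g` from above and is itself bounded by Cramer's rule, so it
  -- cancels at the end.
  obtain ⟨p₀, hp₀⟩ := Finite.exists_max fun p => ‖v p‖
  set L := ‖v p₀‖ with hL
  have hLpos : 0 < L := by
    refine norm_pos_iff.2 fun h0 => hP0 ?_
    have : v = 0 := funext fun p => norm_le_zero_iff.1 ((hp₀ p).trans_eq (norm_eq_zero.2 h0))
    simp [boxPolynomial, this]
  have hg := alongGraph_boxPolynomial f v
  have hgd : DifferentiableOn ℂ (alongGraph f (boxPolynomial v)) (Metric.ball 0 1) := by
    rw [hg]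
    exact DifferentiableOn.fun_sum fun p _ =>
      (differentiableOn_graphMonomial p hf).const_mul (v p)
  have hφ : ∀ p, AnalyticAt ℂ (graphMonomial f (d := d) p) 0 := fun p =>
    (differentiableOn_graphMonomial p hf).analyticAt (Metric.ball_mem_nhds _ one_pos)
  have htaylor : ∀ (u : Fin (d + 1) × Fin (d + 1) → ℂ) k,
      taylorCoeff (alongGraph f (boxPolynomial u)) k =
        ∑ p, u p * taylorCoeff (graphMonomial f p) k := fun u k => by
    rw [alongGraph_boxPolynomial]
    exact taylorCoeff_sum_const_mul _ _ _ (fun p _ => hφ p) k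
  have hgM : ∀ z ∈ Metric.sphere (0 : ℂ) (7 / 8),
      ‖alongGraph f (boxPolynomial v) z‖ ≤ n * (L * M ^ d) := by
    intro z hz
    rw [hg]
    refine (norm_sum_le _ _).trans ?_
    rw [← hcard, ← nsmul_eq_mul, Fintype.card, ← Finset.sum_const]
    refine Finset.sum_le_sum fun p _ => ?_
    rw [norm_mul]
    have hz1 : ‖z‖ = 7 / 8 := by simpa using hz
    exact mul_le_mul (hp₀ p) (norm_graphMonomial_le p hM1 (by rw [hz1]; norm_num)
      (hM z (Metric.sphere_subset_closedBall hz))) (norm_nonneg _) hLpos.le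
  have hsmall := norm_le_of_le_sum_analyticOrderAt s hs K _ _ hgd hgM hK
  have hgt : ∀ k ≤ N, ‖taylorCoeff (alongGraph f (boxPolynomial v)) k‖ ≤
      n * (L * M ^ d) * (4 / 5) ^ K * 4 ^ N := by
    intro k hk
    refine (norm_taylorCoeff_le (r := 1 / 4) (by norm_num) (by norm_num) hgd
      (fun z hz => hsmall z (Metric.sphere_subset_closedBall hz)) k).trans ?_
    rw [one_div, inv_pow, div_inv_eq_mul]
    gcongr
    norm_num
  have hint : ∀ (k : Fin (N + 1)) (p : Fin (d + 1) × Fin (d + 1)), ∃ m : ℤ,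
      ((q : ℂ) ^ d) * taylorCoeff (graphMonomial f p) k = m := fun k p => by
    simpa using hasDenominator_graphMonomial p hf0 hq k (Nat.lt_succ_iff.1 k.is_lt)
  choose B hB using hint
  have hmulVec : ∀ (u : Fin (d + 1) × Fin (d + 1) → ℂ) k,
      ((Matrix.of B).map (Int.cast : ℤ → ℂ)).mulVec u k =
        (q : ℂ) ^ d * taylorCoeff (alongGraph f (boxPolynomial u)) k := by
    intro u k
    rw [htaylor, Finset.mul_sum]
    refine Finset.sum_congr rfl fun p _ => ?_
    simp only [Matrix.map_apply, Matrix.of_apply]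
    rw [← hB]
    ring
  have hBb : ∀ k p, |((Matrix.of B k p : ℤ) : ℝ)| ≤ b := by
    intro k p
    have h1 : |((Matrix.of B k p : ℤ) : ℝ)| = ‖((B k p : ℤ) : ℂ)‖ := by
      rw [Complex.norm_intCast]; rfl
    rw [h1, ← hB, norm_mul, norm_pow, Complex.norm_natCast, hb]
    gcongr
    -- Cauchy's estimate at radius `1/2` gives the factor `2 ^ N` in `b`.
    refine (norm_taylorCoeff_le (r := 1 / 2) (by norm_num) (by norm_num)
      (differentiableOn_graphMonomial p hf) (M := M ^ d) (fun z hz => ?_) k).trans ?_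
    · have hz1 : ‖z‖ = 1 / 2 := by simpa using hz
      refine norm_graphMonomial_le p hM1 (by rw [hz1]; norm_num) (hM z ?_)
      rw [mem_closedBall_zero_iff, hz1]
      norm_num
    · rw [one_div, inv_pow, div_inv_eq_mul]
      gcongr
      · norm_num
      · exact Nat.lt_succ_iff.1 k.is_lt
  have hqd : (q : ℂ) ^ d ≠ 0 := pow_ne_zero _ (by exact_mod_cast (by omega : q ≠ 0))
  have hinj : ∀ u : Fin (d + 1) × Fin (d + 1) → ℂ,
      ((Matrix.of B).map (Int.cast : ℤ → ℂ)).mulVec u = 0 → u = 0 := by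
    intro u hu
    refine eq_zero_of_taylorCoeff_eq_zero hf0 hν u fun k hk => ?_
    have := congrFun hu ⟨k, Nat.lt_succ_iff.2 hk⟩
    rw [hmulVec, Pi.zero_apply] at this
    exact (mul_eq_zero.1 this).resolve_left hqd
  have hfinal := Matrix.norm_apply_le_of_int_of_injective (Matrix.of B) hBb
    (one_le_mul_of_one_le_of_one_le (by simp) (one_le_pow₀ hb1)) hinj v
    (y := (q : ℝ) ^ d * (n * (L * M ^ d) * (4 / 5) ^ K * 4 ^ N)) (by linarith) (fun k => by
      rw [hmulVec, norm_mul, norm_pow, Complex.norm_natCast]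
      gcongr
      exact hgt k (Nat.lt_succ_iff.1 k.is_lt)) p₀
  rw [← hL, hcard, Fintype.card_fin] at hfinal
  push_cast at hfinal
  have hcancel : (5 / 4 : ℝ) ^ K * (4 / 5) ^ K = 1 := by rw [← mul_pow]; norm_num
  refine le_of_mul_le_mul_right ?_ hLpos
  have h54 : (0 : ℝ) ≤ (5 / 4 : ℝ) ^ K := by positivity
  refine (mul_le_mul_of_nonneg_left hfinal h54).trans_eq ?_
  calc _ = (n * (n.factorial * ((N + 1) * b ^ 2) ^ n *
      ((N + 1) * (b * ((q : ℝ) ^ d * (n * M ^ d * 4 ^ N)))))) * L *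
        ((5 / 4 : ℝ) ^ K * (4 / 5) ^ K) := by ring
    _ = _ := by rw [hcancel, mul_one]

/-- A bound for the number of zeros in terms of bounds `N` for the transcendence index, `exp Q` for
the common denominator and `M` for the function. -/
def zeroBound (d N Q M : ℝ) : ℝ :=
  let n := (d + 1) * (d + 1)
  let E := d * Q + (d * M + N)
  5 * (n + (n * n + n * (N + 2 * E) + (N + (E + (d * Q + (n + d * M + 3 * N))))))

/-- Every factor is bounded by an exponential and the exponents are added. The `5` in `zeroBound`
comes from `exp (1/5) ≤ 5/4`. -/
theorem natCast_le_zeroBound {K N d n q : ℕ} {Q M b : ℝ} (hM1 : 1 ≤ M) (hQ : q ≤ Real.exp Q)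
    (hn : n = (d + 1) * (d + 1)) (hb : b = (q : ℝ) ^ d * (M ^ d * 2 ^ N))
    (h : (5 / 4 : ℝ) ^ K ≤ n * (n.factorial * ((N + 1) * b ^ 2) ^ n *
      ((N + 1) * (b * ((q : ℝ) ^ d * (n * M ^ d * 4 ^ N)))))) :
    (K : ℝ) ≤ zeroBound d N Q M := by
  have hexp : ∀ x : ℝ, x + 1 ≤ Real.exp x := Real.add_one_le_exp
  have hle : ∀ x : ℝ, x ≤ Real.exp x := fun x => by linarith [hexp x]
  have hM : M ≤ Real.exp M := hle M
  have hqd : (q : ℝ) ^ d ≤ Real.exp (d * Q) := by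
    rw [Real.exp_nat_mul]
    gcongr
  have hMd : M ^ d ≤ Real.exp (d * M) := by
    rw [Real.exp_nat_mul]
    gcongr
  have h2 : (2 : ℝ) ^ N ≤ Real.exp N := by
    have := hexp 1
    calc (2 : ℝ) ^ N ≤ Real.exp 1 ^ N := by gcongr; linarith
      _ = _ := by rw [← Real.exp_nat_mul, mul_one]
  have h4 : (4 : ℝ) ^ N ≤ Real.exp (3 * N) := by
    have := hexp 3
    calc (4 : ℝ) ^ N ≤ Real.exp 3 ^ N := by gcongr; linarith
      _ = _ := by rw [← Real.exp_nat_mul, mul_comm]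
  have hbE : b ≤ Real.exp (d * Q + (d * M + N)) := by
    rw [hb, Real.exp_add, Real.exp_add]
    gcongr
  have hb0 : 0 ≤ b := by rw [hb]; positivity
  have hfac : (n.factorial : ℝ) ≤ Real.exp (n * n) := by
    calc (n.factorial : ℝ) ≤ (n : ℝ) ^ n := by exact_mod_cast n.factorial_le_pow
      _ ≤ Real.exp n ^ n := by gcongr; exact hle n
      _ = _ := by rw [← Real.exp_nat_mul]
  have h54 : Real.exp ((1 / 5 : ℝ) * K) ≤ (5 / 4) ^ K := by
    rw [mul_comm, Real.exp_nat_mul]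
    gcongr
    have h5 := hexp (-(1 / 5))
    rw [Real.exp_neg] at h5
    have hpos := Real.exp_pos (1 / 5)
    have : (4 / 5 : ℝ) * Real.exp (1 / 5) ≤ 1 := by
      calc (4 / 5 : ℝ) * Real.exp (1 / 5) ≤ (Real.exp (1 / 5))⁻¹ * Real.exp (1 / 5) := by
            gcongr; linarith
        _ = 1 := inv_mul_cancel₀ hpos.ne'
    linarith
  have hmain : Real.exp ((1 / 5 : ℝ) * K) ≤ Real.exp (zeroBound d N Q M / 5) := by
    refine (h54.trans h).trans ?_
    have hn' : (n : ℝ) = (d + 1) * (d + 1) := by rw [hn]; push_cast; ring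
    have hz : zeroBound d N Q M / 5 = n + (n * n + n * (N + 2 * (d * Q + (d * M + N))) +
        (N + ((d * Q + (d * M + N)) + (d * Q + (n + d * M + 3 * N))))) := by
      rw [zeroBound, hn']
      ring
    rw [hz, Real.exp_add n, Real.exp_add (n * n + _), Real.exp_add (n * n), Real.exp_add N,
      Real.exp_add (d * Q + (d * M + N)) (d * Q + _), Real.exp_add (d * Q) (n + _ + _),
      Real.exp_add (n + d * M), Real.exp_add n]
    have hpow : ((N + 1 : ℝ) * b ^ 2) ^ n ≤ Real.exp (n * (N + 2 * (d * Q + (d * M + N)))) := by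
      rw [Real.exp_nat_mul, Real.exp_add]
      have : b ^ 2 ≤ Real.exp (2 * (d * Q + (d * M + N))) := by
        calc b ^ 2 ≤ Real.exp (d * Q + (d * M + N)) ^ 2 := by gcongr
          _ = _ := by rw [← Real.exp_nat_mul]; norm_num
      gcongr
      exact hexp N
    gcongr
    · exact hle n
    · exact hexp N
    · exact hle n
  have := Real.exp_le_exp.1 hmain
  linarith

/-! ### Comparison of extended numbers -/

theorem coe_le_coe_natCast_iff (x : ℕ∞) (n : ℕ) :
    (((x : ℕ∞) : ℝ≥0∞) : EReal) ≤ ((n : ℝ) : EReal) ↔ x ≤ n := by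
  have h : ((n : ℝ) : EReal) = ((((n : ℕ∞) : ℝ≥0∞)) : EReal) := by
    rw [ENat.toENNReal_coe]
    rfl
  rw [h, EReal.coe_ennreal_le_coe_ennreal_iff, ENat.toENNReal_le]

/-- Rounding the coefficients up makes the order `N` a natural number that is still polynomial in
`d`. -/
theorem exists_natPolynomial_ge (R : Polynomial ℝ) :
    ∃ p : Polynomial ℕ, ∀ n : ℕ, R.eval (n : ℝ) ≤ ((p.eval n : ℕ) : ℝ) := by
  induction R using Polynomial.induction_on' with
  | add R₁ R₂ h₁ h₂ =>
    obtain ⟨p₁, h₁⟩ := h₁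
    obtain ⟨p₂, h₂⟩ := h₂
    refine ⟨p₁ + p₂, fun n => ?_⟩
    rw [Polynomial.eval_add, Polynomial.eval_add, Nat.cast_add]
    exact add_le_add (h₁ n) (h₂ n)
  | monomial k c =>
    refine ⟨Polynomial.monomial k ⌈c⌉₊, fun n => ?_⟩
    rw [Polynomial.eval_monomial, Polynomial.eval_monomial]
    push_cast
    gcongr
    exact Nat.le_ceil c

/-! ### The polynomial bound for the number of zeros -/

theorem mainTheorem1 (f : ℂ → ℂ)
    (hf : AnalyticOnNhd ℂ f (Metric.ball (0 : ℂ) 1))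
    (hft : IsTranscendentalOnDisc f)
    (a : ℕ → ℚ)
    (ha : ∀ k : ℕ, iteratedDeriv k f 0 / (k.factorial : ℂ) = (a k : ℂ))
    (R S : Polynomial ℝ)
    (hR : ∀ d : ℕ, 1 ≤ d →
      (((transcendenceIndex f d : ℕ∞) : ℝ≥0∞) : EReal) ≤ ((R.eval (d : ℝ) : ℝ) : EReal))
    (hS : ∀ l : ℕ, 1 ≤ l → (maxDenominator a l : ℝ) ≤ Real.exp (S.eval (l : ℝ))) :
    ∃ T : Polynomial ℝ, ∀ d : ℕ, 1 ≤ d →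
      (((bezoutNumber f (Metric.closedBall (0 : ℂ) (1 / 4)) d : ℕ∞) : ℝ≥0∞) : EReal)
        ≤ ((T.eval (d : ℝ) : ℝ) : EReal) := by
  have hfd : DifferentiableOn ℂ f (Metric.ball 0 1) := hf.differentiableOn
  obtain ⟨M, hM1, hM⟩ : ∃ M : ℝ, 1 ≤ M ∧
      ∀ z ∈ Metric.closedBall (0 : ℂ) (7 / 8), ‖f z‖ ≤ M := by
    obtain ⟨C, hC⟩ := (isCompact_closedBall (0 : ℂ) (7 / 8)).exists_bound_of_continuousOn
      (hfd.continuousOn.mono (Metric.closedBall_subset_ball (by norm_num)))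
    exact ⟨max 1 C, le_max_left _ _, fun z hz => (hC z hz).trans (le_max_right _ _)⟩
  obtain ⟨p, hp⟩ := exists_natPolynomial_ge R
  -- The `+ 1` ensures `N ≥ 1`, so that the bound on `h_N` applies.
  let Np : Polynomial ℝ := (p.map (Nat.castRingHom ℝ)).comp (2 * Polynomial.X) + 1
  let Qp : Polynomial ℝ := Polynomial.C ((a 0).den : ℝ) + Np * S.comp Np
  let np : Polynomial ℝ := (Polynomial.X + 1) * (Polynomial.X + 1)
  let Ep : Polynomial ℝ := Polynomial.X * Qp + (Polynomial.X * Polynomial.C M + Np)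
  refine ⟨5 * (np + (np * np + np * (Np + 2 * Ep) +
    (Np + (Ep + (Polynomial.X * Qp + (np + Polynomial.X * Polynomial.C M + 3 * Np)))))),
    fun d hd => ?_⟩
  set N : ℕ := p.eval (2 * d) + 1 with hN
  set Q : ℝ := (a 0).den + N * S.eval (N : ℝ) with hQ
  have hNp : Np.eval (d : ℝ) = N := by
    have h2 : (2 * d : ℝ) = ((2 * d : ℕ) : ℝ) := by push_cast; ring
    simp only [Np, hN, Polynomial.eval_add, Polynomial.eval_comp, Polynomial.eval_mul,
      Polynomial.eval_X, Polynomial.eval_ofNat, Polynomial.eval_one, h2,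
      Polynomial.eval_natCast_map]
    simp
  have hQp : Qp.eval (d : ℝ) = Q := by
    simp [Qp, hQ, hNp, Polynomial.eval_comp]
  have hT : Polynomial.eval (d : ℝ) (5 * (np + (np * np + np * (Np + 2 * Ep) +
      (Np + (Ep + (Polynomial.X * Qp + (np + Polynomial.X * Polynomial.C M + 3 * Np))))))) =
      zeroBound d N Q M := by
    simp [np, Ep, hNp, hQp, zeroBound, mul_comm M]
  rw [hT]
  have hν : transcendenceIndex f (2 * d) ≤ N := by
    rw [← coe_le_coe_natCast_iff]
    refine (hR (2 * d) (by omega)).trans (EReal.coe_le_coe_iff.2 ((hp _).trans ?_))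
    rw [hN]
    push_cast
    linarith
  set q : ℕ := ∏ k ∈ Finset.range (N + 1), (a k).den with hq
  have hq1 : 1 ≤ q := Finset.prod_pos fun k _ => (a k).den_pos
  have hqf : HasDenominator N q f := by
    have := hasDenominator_prod_den (f := f) ha N
    rwa [hq, Nat.cast_prod]
  have hqQ : (q : ℝ) ≤ Real.exp Q := by
    calc (q : ℝ) ≤ (a 0).den * (maxDenominator a N : ℝ) ^ N := by
          exact_mod_cast prod_den_le a N
      _ ≤ Real.exp ((a 0).den) * Real.exp (S.eval (N : ℝ)) ^ N := by
          gcongr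
          · linarith [Real.add_one_le_exp ((a 0).den : ℝ)]
          · exact hS N (by omega)
      _ = Real.exp Q := by rw [hQ, Real.exp_add, Real.exp_nat_mul]
  have hbound : ∀ P : MvPolynomial (Fin 2) ℂ, P ∈ MvPolynomial.restrictDegree (Fin 2) ℂ d →
      P ≠ 0 → ∀ s : Finset ℂ, (s : Set ℂ) ⊆ Metric.closedBall 0 (1 / 4) → ∀ K : ℕ,
      (K : ℕ∞) ≤ ∑ w ∈ s, analyticOrderAt (alongGraph f P) w → (K : ℝ) ≤ zeroBound d N Q M :=
    fun P hP hP0 s hs K hK => natCast_le_zeroBound hM1 hqQ rfl rfl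
      (pow_le_of_le_sum_analyticOrderAt_alongGraph hfd hM1 hM hq1 hqf hν hP hP0 hs hK rfl rfl)
  -- `S` has no prescribed sign; nonnegativity is the case of `K = 0` zeros of the constant `1`.
  have hT0 : 0 ≤ zeroBound d N Q M := by
    have h1 : (1 : MvPolynomial (Fin 2) ℂ) ∈ MvPolynomial.restrictDegree (Fin 2) ℂ d := by
      rw [MvPolynomial.mem_restrictDegree]
      intro m hm i
      rw [MvPolynomial.support_one, Finset.mem_singleton] at hm
      simp [hm]
    exact_mod_cast hbound 1 h1 one_ne_zero ∅ (by simp) 0 (by simp)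
  refine le_trans ?_ (EReal.coe_le_coe_iff.2 (Nat.floor_le hT0))
  rw [coe_le_coe_natCast_iff]
  refine iSup₂_le fun P hP => iSup₂_le fun s hs => ?_
  by_contra! hlt
  have hK := hbound P hP.1 hP.2 s hs (⌊zeroBound d N Q M⌋₊ + 1) (by
    push_cast
    exact Order.add_one_le_of_lt hlt)
  have := Nat.lt_floor_add_one (zeroBound d N Q M)
  push_cast at hK
  linarith
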